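/- Let $\mathbb K\in\{\mathbb R,\mathbb C\}$. For a separable Banach space $B$ over $\mathbb K$ with dual $B'$, the characteristic function of a Borel probability measure $\nu$ on $B$ is $\phi_\nu(f)=\int_B \exp\big(i\,\mathrm{Re} f(x)+i\,\mathrm{Im} f(x)\big)\,d\nu(x)$, $f\in B'$. The measure $\nu$ is Gaussian if every $f\in B'$ is, under $\nu$, a (possibly degenerate) $\mathbb K$-valued Gaussian random variable, i.e. $(\mathrm{Re} f,\mathrm{Im} f)$ is a real Gaussian vector. A Gaussian measure $\nu$ is centred if $\mathbb E_\nu f=0$ for all $f\in B'$, proper if moreover $\mathbb E_\nu[fg]=0$ for all $f,g\in B'$, and non-degenerate if its covariance is positive definite, i.e. $\mathbb E_\nu|f-\mathbb E_\nu f|^2>0$ for all $f\in B'\setminus\{0\}$. "Centred resp. proper" means centred if $\mathbb K=\mathbb R$ and proper if $\mathbb K=\mathbb C$. A triple $(H,B,\nu)$ is an abstract Wiener space over $\mathbb K$ if $H$ is a separable Hilbert space and $B$ a separable Banach space over $\mathbb K$, $H$ is a dense linear subspace of $B$ with continuous inclusion (up to identifying $H$ with its image under an injective continuous linear map into $B$),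 and $\nu$ is a Borel probability measure on $B$ with $\phi_\nu(f)=\exp\big(-\tfrac12\|f|_H\|_{H'}^2\big)$ for all $f\in B'$. (i) Let $H$ be a separable, infinite-dimensional Hilbert space over $\mathbb K$. For any bounded self-adjoint Hilbert–Schmidt operator $A$ on $H'$ that is positive, in the sense that $(Af,f)_{H'}>0$ for all $f\neq0$, there exist a separable, infinite-dimensional Banach (in fact Hilbert) space $B$ over $\mathbb K$ and a probability measure $\nu$ on the Borel $\sigma$-algebra of $B$ such that $(H,B,\nu)$ is an abstract Wiener space. (ii) Let $B$ be a separable, infinite-dimensional Banach space over $\mathbb K$ and let $\nu$ be a probability measure on its Borel $\sigma$-algebra. Then $\nu$ is a non-degenerate centred resp. proper Gaussian measure if and only if there is a separable, infinite-dimensional Hilbert space $H$ over $\mathbb K$ for which $(H,B,\nu)$ is an abstract Wiener space. Moreover such an $H$ is unique: if $(H_1,B,\nu)$ and $(H_2,B,\nu)$ are abstract Wiener spaces, then $H_1=H_2$ as linear subspaces of $B$, with the same inner product. -/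

import Mathlib

open MeasureTheory ProbabilityTheory

universe u

noncomputable section

namespace Wiener

/-! ### Gaussian measures on a Banach space over `𝕜 = ℝ` or `ℂ` -/

section Gaussian

variable (𝕜 : Type) [RCLike 𝕜] {B : Type u} [NormedAddCommGroup B] [NormedSpace 𝕜 B]
  [MeasurableSpace B]

/-- `ν` is a Gaussian measure: each `f ∈ B'` is, under `ν`, a `𝕜`-valued Gaussian random variable,
that is, the law of `f` on `𝕜` (seen as a real vector space of dimension one or two) is a
real Gaussian law. Gaussian laws may be degenerate, e.g. Dirac masses. -/
def IsGaussianMeasure (ν : Measure B) : Prop :=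
  ∀ f : StrongDual 𝕜 B, IsGaussian (ν.map f)

variable {𝕜}

/-- The mean function `m(f) = E f`. -/
def mean (ν : Measure B) (f : StrongDual 𝕜 B) : 𝕜 := ∫ x, f x ∂ν

/-- The covariance function `c(f, g) = E[(f - E f) conj(g - E g)]`. -/
def cov (ν : Measure B) (f g : StrongDual 𝕜 B) : 𝕜 :=
  ∫ x, (f x - mean ν f) * (starRingEnd 𝕜) (g x - mean ν g) ∂ν

/-- The pseudo-covariance function `p(f, g) = E[(f - E f)(g - E g)]`. -/
def pcov (ν : Measure B) (f g : StrongDual 𝕜 B) : 𝕜 :=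
  ∫ x, (f x - mean ν f) * (g x - mean ν g) ∂ν

variable (𝕜)

/-- Centred: the mean function vanishes. -/
def IsCentred (ν : Measure B) : Prop := ∀ f : StrongDual 𝕜 B, mean ν f = 0

/-- Proper: the mean and the pseudo-covariance functions vanish. -/
def IsProper (ν : Measure B) : Prop :=
  IsCentred 𝕜 ν ∧ ∀ f g : StrongDual 𝕜 B, pcov ν f g = 0

/-- "Centred resp. proper": centred if `𝕜 = ℝ` (i.e. `I = 0` in `𝕜`), proper if `𝕜 = ℂ`. -/
def IsCentredRespProper (ν : Measure B) : Prop :=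
  ((RCLike.I : 𝕜) = 0 → IsCentred 𝕜 ν) ∧ ((RCLike.I : 𝕜) ≠ 0 → IsProper 𝕜 ν)

/-- Non-degenerate: the covariance function is positive definite. -/
def IsNondegenerate (ν : Measure B) : Prop :=
  ∀ f : StrongDual 𝕜 B, f ≠ 0 → 0 < RCLike.re (cov ν f f)

variable {𝕜}

/-- The characteristic function `φ_ν(f) = ∫ exp(i Re f + i Im f) dν` on `B'`. -/
def charFn (ν : Measure B) (f : StrongDual 𝕜 B) : ℂ :=
  ∫ x, Complex.exp (((RCLike.re (f x) + RCLike.im (f x) : ℝ) : ℂ) * Complex.I) ∂ν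

end Gaussian

/-! ### Abstract Wiener spaces -/

/-- `(H, B, ν)` is an abstract Wiener space over `𝕜`, where the inclusion `H ⊆ B` is the continuous
linear map `i`. For `f ∈ B'`, the functional `f ∘ i ∈ H'` is the restriction of `f` to `H`. -/
structure IsAbstractWienerSpace {𝕜 : Type} [RCLike 𝕜]
    {H : Type u} [NormedAddCommGroup H] [InnerProductSpace 𝕜 H]
    {B : Type u} [NormedAddCommGroup B] [NormedSpace 𝕜 B] [MeasurableSpace B]
    (i : H →L[𝕜] B) (ν : Measure B) : Prop where
  completeSpace_H : CompleteSpace H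
  separableSpace_H : TopologicalSpace.SeparableSpace H
  completeSpace_B : CompleteSpace B
  separableSpace_B : TopologicalSpace.SeparableSpace B
  borelSpace_B : BorelSpace B
  injective : Function.Injective i
  denseRange : DenseRange i
  isProbabilityMeasure : IsProbabilityMeasure ν
  charFn_eq : ∀ f : StrongDual 𝕜 B,
    charFn ν f = Complex.exp (-(1 / 2 : ℂ) * ((‖f.comp i‖ ^ 2 : ℝ) : ℂ))

/-! ### Operators on the dual `H'` of a Hilbert space `H` -/

section Operators

variable {𝕜 : Type} [RCLike 𝕜] {H : Type u} [NormedAddCommGroup H] [InnerProductSpace 𝕜 H]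
  [CompleteSpace H]

/-- The inner product `(f, g)_{H'}`, linear in `f` and conjugate-linear in `g`, obtained from that
of `H` through the (conjugate-linear) Riesz identification. It induces the operator norm. -/
def dualInner (f g : StrongDual 𝕜 H) : 𝕜 :=
  inner 𝕜 ((InnerProductSpace.toDual 𝕜 H).symm f) ((InnerProductSpace.toDual 𝕜 H).symm g)

/-- `A` is self-adjoint on `H'`. -/
def IsSelfAdjointOp (A : StrongDual 𝕜 H →L[𝕜] StrongDual 𝕜 H) : Prop :=
  ∀ f g, dualInner (A f) g = dualInner f (A g)

/-- `A` is (strictly) positive on `H'`. -/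
def IsPositiveOp (A : StrongDual 𝕜 H →L[𝕜] StrongDual 𝕜 H) : Prop :=
  ∀ f, f ≠ 0 → 0 < RCLike.re (dualInner (A f) f)

/-- `A` is Hilbert-Schmidt on `H'`: `∑ ‖A fₙ‖² < ∞` for an orthonormal basis `fₙ` of `H'`. The
orthonormal bases of `H'` are the images of those of `H` under the Riesz identification. -/
def IsHilbertSchmidtOp (A : StrongDual 𝕜 H →L[𝕜] StrongDual 𝕜 H) : Prop :=
  ∃ (w : Set H) (b : HilbertBasis w 𝕜 H),
    Summable fun k : w => ‖A (InnerProductSpace.toDual 𝕜 H (b k))‖ ^ 2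

end Operators

end Wiener

end

/-! Both fields are handled together through the identity Re z + Im z = Re((1 - I)z), valid also
over ℝ, where I = 0. It makes `charFn` at f the usual characteristic function at the real functional
Re((1 - I)f). Since 1 - I is invertible, `charFn` determines the law of every real functional. The
norm |1 - I|, equal to 1 or √2, is the only trace of the field.

In an abstract Wiener space, Re f is therefore N(0, ‖f ∘ i‖²/|1 - I|²). Applying this to f, -If and
(1 - I)f gives centredness and properness; density of H gives non-degeneracy. Conversely, take the
closure of {conj f : f ∈ B'} in L²(ν), embedded by g ↦ ∫ g(x) x dν(x). Then f(i g) = ⟨conj f, g⟩, so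
‖f ∘ i‖² = E|f|² (`norm_comp_cameronMartinInclusion_sq`), and properness identifies the
characteristic function (`charFn_eq_exp_integral_norm_sq`).

For uniqueness, ν determines ‖f ∘ i‖ for every f, and by reflexivity the functionals f ∘ i are dense
in H'. Evaluation at a point of H₁ thus extends to H₂' and is given by a point of H₂ of no larger
norm.

For existence, B is H itself and i is A carried to H by Riesz. The measure is the law of ∑ ξₖ A bₖ,
an orthogonal series in L² that converges because A is Hilbert–Schmidt; Parseval gives its
characteristic function. -/

namespace Wiener

open scoped ComplexConjugate NNReal

/-! ### Hahn–Banach density and reflexivity of Hilbert spaces -/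

section DualDensity

variable {𝕜 : Type*} [RCLike 𝕜]

/-- Hahn–Banach: the dual of the quotient by the closure of `p` separates points, and its
functionals pull back to functionals vanishing on `p`. -/
theorem dense_of_forall_strongDual_eq_zero {E : Type*} [NormedAddCommGroup E] [NormedSpace 𝕜 E]
    (p : Submodule 𝕜 E) (h : ∀ f : StrongDual 𝕜 E, (∀ x ∈ p, f x = 0) → f = 0) :
    Dense (p : Set E) := by
  let q := p.topologicalClosure
  have hq : IsClosed (q : Set E) := p.isClosed_topologicalClosure
  have hmem : ∀ x, x ∈ q := by
    intro x
    rw [← Submodule.Quotient.mk_eq_zero q]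
    refine SeparatingDual.eq_zero_of_forall_dual_eq_zero (R := 𝕜) fun g => ?_
    have h0 : g.comp q.mkQL = 0 := h _ fun y hy => by
      have : (Submodule.Quotient.mk y : E ⧸ q) = 0 :=
        (Submodule.Quotient.mk_eq_zero q).2 (p.le_topologicalClosure hy)
      simp [this]
    exact DFunLike.congr_fun h0 x
  intro x
  exact hmem x

theorem exists_eq_eval_of_strongDual_strongDual {H : Type*} [NormedAddCommGroup H]
    [InnerProductSpace 𝕜 H] [CompleteSpace H] (Φ : StrongDual 𝕜 (StrongDual 𝕜 H)) :
    ∃ h : H, ‖h‖ ≤ ‖Φ‖ ∧ ∀ l : StrongDual 𝕜 H, Φ l = l h := by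
  let l₀ : StrongDual 𝕜 H := LinearMap.mkContinuous
    { toFun := fun y => conj (Φ (InnerProductSpace.toDual 𝕜 H y))
      map_add' := by simp
      map_smul' := fun m x => by
        rw [map_smulₛₗ, map_smul, smul_eq_mul, map_mul, RCLike.conj_conj]; rfl } ‖Φ‖ (fun y => by
        simpa using Φ.le_opNorm (InnerProductSpace.toDual 𝕜 H y))
  refine ⟨(InnerProductSpace.toDual 𝕜 H).symm l₀, ?_, fun l => ?_⟩
  · rw [LinearIsometryEquiv.norm_map]
    exact LinearMap.mkContinuous_norm_le _ (norm_nonneg Φ) _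
  · obtain ⟨y, rfl⟩ := (InnerProductSpace.toDual 𝕜 H).surjective l
    rw [InnerProductSpace.toDual_apply_apply, ← inner_conj_symm,
      InnerProductSpace.toDual_symm_apply]
    simp [l₀]

/-- By reflexivity, a functional on H' that kills every f ∘ i is evaluation at some h with f(i h) =
0 for all f, so i h = 0. -/
theorem denseRange_comp_of_injective {H B : Type*} [NormedAddCommGroup H]
    [InnerProductSpace 𝕜 H] [CompleteSpace H] [NormedAddCommGroup B] [NormedSpace 𝕜 B]
    (i : H →L[𝕜] B) (hi : Function.Injective i) :
    DenseRange fun f : StrongDual 𝕜 B => f.comp i := by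
  let e : StrongDual 𝕜 B →ₗ[𝕜] StrongDual 𝕜 H :=
    { toFun := fun f => f.comp i, map_add' := fun _ _ => rfl, map_smul' := fun _ _ => rfl }
  refine dense_of_forall_strongDual_eq_zero (LinearMap.range e) fun Φ hΦ => ?_
  obtain ⟨h, -, hh⟩ := exists_eq_eval_of_strongDual_strongDual Φ
  have h0 : i h = 0 := SeparatingDual.eq_zero_of_forall_dual_eq_zero (R := 𝕜) fun g =>
    (hh (e g)).symm.trans (hΦ _ ⟨g, rfl⟩)
  have : h = 0 := hi (by simpa using h0)
  ext l
  simp [hh, this]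

end DualDensity

/-! ### Reduction to real functionals -/

section RealPart

variable {𝕜 : Type} [RCLike 𝕜] {B : Type u} [NormedAddCommGroup B] [NormedSpace 𝕜 B]
  [NormedSpace ℝ B] [IsScalarTower ℝ 𝕜 B]

/-- The real functional `x ↦ Re f(x)`. -/
noncomputable def reDual (f : StrongDual 𝕜 B) : StrongDual ℝ B :=
  (RCLike.reCLM (K := 𝕜)).comp (f.restrictScalars ℝ)

@[simp]
theorem reDual_apply (f : StrongDual 𝕜 B) (x : B) : reDual f x = RCLike.re (f x) := rfl

theorem exists_reDual_eq (L : StrongDual ℝ B) : ∃ f : StrongDual 𝕜 B, reDual f = L :=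
  ⟨L.extendRCLike, by ext; simp⟩

theorem re_one_sub_I_mul (z : 𝕜) :
    RCLike.re ((1 - RCLike.I) * z) = RCLike.re z + RCLike.im z := by
  rw [sub_mul, one_mul, map_sub, RCLike.mul_re, RCLike.I_re, zero_mul, zero_sub, mul_comm,
    RCLike.mul_im_I_ax, sub_neg_eq_add]

theorem one_sub_I_ne_zero : (1 - RCLike.I : 𝕜) ≠ 0 := fun h => by
  simpa using congrArg RCLike.re h

variable [MeasurableSpace B]

theorem charFn_eq_charFunDual (ν : Measure B) (f : StrongDual 𝕜 B) :
    charFn ν f = charFunDual ν (reDual ((1 - RCLike.I : 𝕜) • f)) := by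
  simp only [charFn, charFunDual_apply, reDual_apply, smul_apply, smul_eq_mul, re_one_sub_I_mul]

theorem charFunDual_reDual (ν : Measure B) (f : StrongDual 𝕜 B) :
    charFunDual ν (reDual f) = charFn ν ((1 - RCLike.I : 𝕜)⁻¹ • f) := by
  rw [charFn_eq_charFunDual, smul_inv_smul₀ one_sub_I_ne_zero]

variable [BorelSpace B]

/-- Every real functional is the real part of a 𝕜-linear one, and every 𝕜-linear functional is a
real-linear map into 𝕜. -/
theorem isGaussianMeasure_iff_isGaussian (ν : Measure B) :
    IsGaussianMeasure 𝕜 ν ↔ IsGaussian ν := by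
  refine ⟨fun h => isGaussian_of_isGaussian_map fun L => ?_, fun h f => ?_⟩
  · obtain ⟨f, rfl⟩ := exists_reDual_eq (𝕜 := 𝕜) L
    have := h f
    have h2 : ν.map (reDual f) = (ν.map f).map (RCLike.reCLM (K := 𝕜)) := by
      rw [Measure.map_map (by fun_prop) (by fun_prop)]
      rfl
    rw [h2]
    infer_instance
  · exact isGaussian_map (μ := ν) (f.restrictScalars ℝ)

/-- The real part of each `f` is a centred Gaussian of variance `‖f ∘ i‖² / |1 - I|²`. -/
theorem map_reDual_eq_gaussianReal {H : Type u} [NormedAddCommGroup H] [InnerProductSpace 𝕜 H]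
    {i : H →L[𝕜] B} {ν : Measure B} (h : IsAbstractWienerSpace i ν) (f : StrongDual 𝕜 B) :
    ν.map (reDual f) = gaussianReal 0 ((‖f.comp i‖₊ / ‖(1 - RCLike.I : 𝕜)‖₊) ^ 2) := by
  have := h.isProbabilityMeasure
  refine Measure.ext_of_charFun ?_
  ext t
  have ht : t • reDual f = reDual ((t : 𝕜) • f) := by ext; simp
  rw [charFun_map_eq_charFunDual_smul, ht, charFunDual_reDual, h.charFn_eq, charFun_gaussianReal]
  congr 1
  simp only [ContinuousLinearMap.smul_comp, norm_smul, norm_inv, RCLike.norm_ofReal]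
  push_cast
  rw [mul_pow, mul_pow, ← Complex.ofReal_pow |t|, sq_abs]
  push_cast
  ring

end RealPart

/-! ### Moments of an abstract Wiener measure -/

section Moments

variable {𝕜 : Type} [RCLike 𝕜] {B : Type u} [NormedAddCommGroup B] [NormedSpace 𝕜 B]
  [MeasurableSpace B] {ν : Measure B} {H : Type u} [NormedAddCommGroup H]
  [InnerProductSpace 𝕜 H] {i : H →L[𝕜] B}

theorem re_cov_self (hc : IsCentred 𝕜 ν) (f : StrongDual 𝕜 B) :
    RCLike.re (cov ν f f) = ∫ x, ‖f x‖ ^ 2 ∂ν := by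
  simp only [cov, hc f, sub_zero, RCLike.mul_conj]
  norm_cast

variable [NormedSpace ℝ B] [IsScalarTower ℝ 𝕜 B] [BorelSpace B]

theorem IsAbstractWienerSpace.isGaussian (h : IsAbstractWienerSpace i ν) : IsGaussian ν :=
  isGaussian_of_map_eq_gaussianReal fun L => by
    obtain ⟨f, rfl⟩ := exists_reDual_eq (𝕜 := 𝕜) L
    exact ⟨_, _, map_reDual_eq_gaussianReal h f⟩

theorem IsAbstractWienerSpace.integral_re_dual (h : IsAbstractWienerSpace i ν)
    (f : StrongDual 𝕜 B) : ∫ x, RCLike.re (f x) ∂ν = 0 := by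
  have h1 : ∫ y, y ∂(ν.map (reDual f)) = 0 := by
    rw [map_reDual_eq_gaussianReal h f, integral_id_gaussianReal]
  rwa [integral_map (by fun_prop) (by fun_prop)] at h1

theorem IsAbstractWienerSpace.integral_re_dual_sq (h : IsAbstractWienerSpace i ν)
    (f : StrongDual 𝕜 B) :
    ∫ x, RCLike.re (f x) ^ 2 ∂ν = (‖f.comp i‖ / ‖(1 - RCLike.I : 𝕜)‖) ^ 2 := by
  have h1 : Var[id; ν.map (reDual f)] = (‖f.comp i‖ / ‖(1 - RCLike.I : 𝕜)‖) ^ 2 := by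
    rw [map_reDual_eq_gaussianReal h f, variance_id_gaussianReal]
    simp
  rwa [variance_map (by fun_prop) (by fun_prop), Function.id_comp,
    variance_of_integral_eq_zero (by fun_prop)
      (show ∫ x, reDual f x ∂ν = 0 from h.integral_re_dual f)] at h1

variable [CompleteSpace B] [SecondCountableTopology B]

theorem memLp_two_dual [IsGaussian ν] (f : StrongDual 𝕜 B) : MemLp f 2 ν :=
  (f.restrictScalars ℝ).comp_memLp' IsGaussian.memLp_two_id

theorem integrable_dual [IsGaussian ν] (f : StrongDual 𝕜 B) : Integrable f ν :=
  (memLp_two_dual f).integrable one_le_two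

theorem integrable_dual_mul [IsGaussian ν] (f g : StrongDual 𝕜 B) :
    Integrable (fun x => f x * g x) ν :=
  (memLp_two_dual f).integrable_mul (memLp_two_dual g)

/-- Im f = Re(-If), so the vanishing mean of real parts suffices. Over ℝ the imaginary part is zero
anyway. -/
theorem IsAbstractWienerSpace.isCentred (h : IsAbstractWienerSpace i ν) : IsCentred 𝕜 ν := by
  have := h.isGaussian
  have hre (f : StrongDual 𝕜 B) : RCLike.re (mean ν f) = 0 := by
    rw [mean, ← _root_.integral_re (integrable_dual f)]
    exact h.integral_re_dual f
  intro f
  have h2 := hre ((-RCLike.I : 𝕜) • f)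
  have h3 : mean ν ((-RCLike.I : 𝕜) • f) = -RCLike.I * mean ν f := by
    simp only [mean, smul_apply, smul_eq_mul, integral_const_mul]
  rw [h3, neg_mul, map_neg, RCLike.mul_re, RCLike.I_re, zero_mul, zero_sub, neg_neg, mul_comm,
    RCLike.mul_im_I_ax] at h2
  exact RCLike.ext (by simp [hre]) (by simp [h2])

/-- Re(f²) = (Re f)² - (Re(-If))², and both terms have the same expectation because f and -If
restrict to H with equal norms. -/
theorem IsAbstractWienerSpace.isProper (h : IsAbstractWienerSpace i ν)
    (hI : (RCLike.I : 𝕜) ≠ 0) : IsProper 𝕜 ν := by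
  have := h.isGaussian
  have hII : (RCLike.I : 𝕜) * RCLike.I = -1 := RCLike.I_mul_I_of_nonzero hI
  have hre (f : StrongDual 𝕜 B) : RCLike.re (∫ x, f x * f x ∂ν) = 0 := by
    have hr (g : StrongDual 𝕜 B) : Integrable (fun x => RCLike.re (g x) ^ 2) ν :=
      (memLp_two_dual g).re.integrable_sq
    have h1 := h.integral_re_dual_sq ((-RCLike.I : 𝕜) • f)
    have hn : ‖(-RCLike.I : 𝕜)‖ = 1 := by rw [norm_neg, RCLike.norm_I_of_ne_zero hI]
    rw [ContinuousLinearMap.smul_comp, norm_smul, hn, one_mul, ← h.integral_re_dual_sq f] at h1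
    rw [← _root_.integral_re (integrable_dual_mul f f)]
    have h2 (x : B) : RCLike.re (f x * f x)
        = RCLike.re (f x) ^ 2 - RCLike.re (((-RCLike.I : 𝕜) • f) x) ^ 2 := by
      rw [smul_apply, smul_eq_mul, neg_mul, map_neg, RCLike.mul_re (RCLike.I : 𝕜), RCLike.I_re,
        mul_comm (RCLike.im _), RCLike.mul_im_I_ax, RCLike.mul_re]
      ring
    simp only [h2]
    rw [integral_sub (hr f) (hr _), h1, sub_self]
  have hsq (f : StrongDual 𝕜 B) : ∫ x, f x * f x ∂ν = 0 := by
    refine RCLike.ext (by simp [hre]) ?_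
    -- As (1 - I)² = -2I, the real part of ((1 - I)f)² is 2 Im(f²).
    have h1 := hre ((1 - RCLike.I : 𝕜) • f)
    have h2 (x : B) : ((1 - RCLike.I : 𝕜) • f) x * ((1 - RCLike.I : 𝕜) • f) x
        = (-RCLike.I) * (2 * (f x * f x)) := by
      simp only [smul_apply, smul_eq_mul]
      linear_combination (f x) ^ 2 * hII
    simp only [h2, integral_const_mul] at h1
    rw [neg_mul, map_neg, RCLike.mul_re, RCLike.I_re, mul_comm (RCLike.im _),
      RCLike.mul_im_I_ax, ← Nat.cast_ofNat, ← nsmul_eq_mul, map_nsmul] at h1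
    simpa using h1
  refine ⟨h.isCentred, fun f g => ?_⟩
  -- Polarisation.
  have h1 := hsq (f + g)
  have h2 (x : B) : (f + g) x * (f + g) x = f x * f x + g x * g x + 2 * (f x * g x) := by
    simp only [add_apply]; ring
  simp only [h2] at h1
  rw [integral_add (by exact (integrable_dual_mul f f).add (integrable_dual_mul g g))
    ((integrable_dual_mul f g).const_mul 2),
    integral_add (integrable_dual_mul f f) (integrable_dual_mul g g), hsq, hsq,
    integral_const_mul] at h1
  simp only [pcov, h.isCentred f, h.isCentred g, sub_zero]
  simpa using h1

theorem IsAbstractWienerSpace.isCentredRespProper (h : IsAbstractWienerSpace i ν) :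
    IsCentredRespProper 𝕜 ν :=
  ⟨fun _ => h.isCentred, h.isProper⟩

theorem IsAbstractWienerSpace.isNondegenerate (h : IsAbstractWienerSpace i ν) :
    IsNondegenerate 𝕜 ν := by
  have := h.isGaussian
  intro f hf
  rw [re_cov_self h.isCentred]
  have hne : f.comp i ≠ 0 := fun h0 => hf <| by
    have : (f : B → 𝕜) = (0 : StrongDual 𝕜 B) :=
      h.denseRange.equalizer f.continuous (0 : StrongDual 𝕜 B).continuous
        (funext fun x => DFunLike.congr_fun h0 x)
    exact DFunLike.coe_injective this
  calc 0 < (‖f.comp i‖ / ‖(1 - RCLike.I : 𝕜)‖) ^ 2 :=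
        pow_pos (div_pos (norm_pos_iff.2 hne) (norm_pos_iff.2 one_sub_I_ne_zero)) 2
    _ = ∫ x, RCLike.re (f x) ^ 2 ∂ν := (h.integral_re_dual_sq f).symm
    _ ≤ ∫ x, ‖f x‖ ^ 2 ∂ν := by
        refine integral_mono (memLp_two_dual f).re.integrable_sq
          (memLp_two_dual f).norm.integrable_sq fun x => ?_
        exact sq_le_sq' (by have := RCLike.abs_re_le_norm (f x); rw [abs_le] at this; exact this.1)
          (RCLike.re_le_norm _)

/-- The square of Re((1 - I)f) is |f|² + Im(f²). The second term integrates to zero, by properness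
or because 𝕜 = ℝ. -/
theorem charFn_eq_exp_integral_norm_sq [IsGaussian ν] (hν : IsCentredRespProper 𝕜 ν)
    (f : StrongDual 𝕜 B) :
    charFn ν f = Complex.exp (-(1 / 2 : ℂ) * ((∫ x, ‖f x‖ ^ 2 ∂ν : ℝ) : ℂ)) := by
  have hc : IsCentred 𝕜 ν := by
    by_cases hI : (RCLike.I : 𝕜) = 0
    exacts [hν.1 hI, (hν.2 hI).1]
  set g := (1 - RCLike.I : 𝕜) • f with hg
  have hm : ∫ x, reDual g x ∂ν = 0 := by
    have : ∫ x, RCLike.re (g x) ∂ν = RCLike.re (mean ν g) := _root_.integral_re (integrable_dual g)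
    simpa [hc g] using this
  have him : ∫ x, RCLike.im (f x * f x) ∂ν = 0 := by
    rw [integral_im (integrable_dual_mul f f)]
    by_cases hI : (RCLike.I : 𝕜) = 0
    · rw [← RCLike.mul_im_I_ax, hI]; simp
    · have := (hν.2 hI).2 f f
      simp only [pcov, hc f, sub_zero] at this
      simp [this]
  have hv : Var[reDual g; ν] = ∫ x, ‖f x‖ ^ 2 ∂ν := by
    rw [variance_of_integral_eq_zero (by fun_prop) hm]
    have hx (x : B) : (reDual g x) ^ 2 = ‖f x‖ ^ 2 + RCLike.im (f x * f x) := by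
      rw [reDual_apply, hg, smul_apply, smul_eq_mul, re_one_sub_I_mul, RCLike.norm_sq_eq_def,
        RCLike.mul_im]
      ring
    simp only [hx]
    rw [integral_add (memLp_two_dual f).norm.integrable_sq (integrable_dual_mul f f).im, him,
      add_zero]
  rw [charFn_eq_charFunDual, IsGaussian.charFunDual_eq, ← hg, hv, integral_complex_ofReal, hm]
  congr 1
  push_cast
  ring

end Moments

/-! ### Uniqueness of the Hilbert space -/

section Uniqueness

variable {𝕜 : Type} [RCLike 𝕜] {B : Type u} [NormedAddCommGroup B] [NormedSpace 𝕜 B]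
  [MeasurableSpace B] {ν : Measure B}
  {H₁ H₂ : Type u} [NormedAddCommGroup H₁] [InnerProductSpace 𝕜 H₁]
  [NormedAddCommGroup H₂] [InnerProductSpace 𝕜 H₂] {i₁ : H₁ →L[𝕜] B} {i₂ : H₂ →L[𝕜] B}

theorem IsAbstractWienerSpace.norm_comp_eq (h₁ : IsAbstractWienerSpace i₁ ν)
    (h₂ : IsAbstractWienerSpace i₂ ν) (f : StrongDual 𝕜 B) : ‖f.comp i₁‖ = ‖f.comp i₂‖ := by
  have h := (h₁.charFn_eq f).symm.trans (h₂.charFn_eq f)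
  have h' : Real.exp (-(1 / 2) * ‖f.comp i₁‖ ^ 2) = Real.exp (-(1 / 2) * ‖f.comp i₂‖ ^ 2) := by
    apply Complex.ofReal_injective
    push_cast at h ⊢
    exact h
  have h2 := Real.exp_injective h'
  exact (sq_eq_sq₀ (norm_nonneg _) (norm_nonneg _)).1 (by linarith)

theorem IsAbstractWienerSpace.exists_norm_le (h₁ : IsAbstractWienerSpace i₁ ν)
    (h₂ : IsAbstractWienerSpace i₂ ν) (x : H₁) : ∃ y : H₂, ‖y‖ ≤ ‖x‖ ∧ i₂ y = i₁ x := by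
  have := h₂.completeSpace_H
  let e : StrongDual 𝕜 B →ₗ[𝕜] StrongDual 𝕜 H₂ :=
    { toFun := fun f => f.comp i₂, map_add' := fun _ _ => rfl, map_smul' := fun _ _ => rfl }
  let ev : StrongDual 𝕜 B →ₗ[𝕜] 𝕜 :=
    { toFun := fun f => f (i₁ x), map_add' := fun _ _ => rfl, map_smul' := fun _ _ => rfl }
  have hd : DenseRange e := denseRange_comp_of_injective i₂ h₂.injective
  have hb (f : StrongDual 𝕜 B) : ‖ev f‖ ≤ ‖x‖ * ‖e f‖ := by
    have := (f.comp i₁).le_opNorm x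
    rw [h₁.norm_comp_eq h₂] at this
    rwa [mul_comm]
  -- The assignment f ∘ i₂ ↦ f(i₁ x) has bound ‖x‖ on a dense subspace of H₂'; its extension to H₂'
  -- is evaluation at `y`.
  obtain ⟨y, hy, hy'⟩ := exists_eq_eval_of_strongDual_strongDual (ev.extendOfNorm e)
  refine ⟨y, hy.trans (LinearMap.opNorm_extendOfNorm_le hd (norm_nonneg x) hb), ?_⟩
  refine (SeparatingDual.eq_iff_forall_dual_eq (R := 𝕜)).2 fun f => ?_
  have h1 := LinearMap.extendOfNorm_eq hd ⟨_, hb⟩ f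
  rw [hy'] at h1
  exact h1

theorem IsAbstractWienerSpace.exists_linearIsometryEquiv (h₁ : IsAbstractWienerSpace i₁ ν)
    (h₂ : IsAbstractWienerSpace i₂ ν) : ∃ U : H₁ ≃ₗᵢ[𝕜] H₂, ∀ x, i₂ (U x) = i₁ x := by
  choose U hU hiU using h₁.exists_norm_le h₂
  choose V hV hiV using h₂.exists_norm_le h₁
  -- Injectivity of the inclusions makes the two contractions mutually inverse, hence isometric, and
  -- makes `U` linear.
  have hVU (x : H₁) : V (U x) = x := h₁.injective (by rw [hiV, hiU])
  have hUV (y : H₂) : U (V y) = y := h₂.injective (by rw [hiU, hiV])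
  refine ⟨⟨⟨⟨⟨U, fun x y => ?_⟩, fun c x => ?_⟩, V, hVU, hUV⟩, fun x => ?_⟩, hiU⟩
  · exact h₂.injective (by simp [hiU])
  · exact h₂.injective (by simp [hiU])
  · refine le_antisymm (hU x) ?_
    have := hV (U x)
    rwa [hVU] at this

end Uniqueness

/-! ### The Cameron–Martin space of a Gaussian measure -/

section Construction

variable {𝕜 : Type} [RCLike 𝕜] {B : Type u} [NormedAddCommGroup B] [NormedSpace 𝕜 B]
  [NormedSpace ℝ B] [IsScalarTower ℝ 𝕜 B] [CompleteSpace B] [SecondCountableTopology B]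
  [MeasurableSpace B] [BorelSpace B] (ν : Measure B) [IsGaussian ν]

theorem memLp_two_conj_dual (f : StrongDual 𝕜 B) : MemLp (fun x => conj (f x)) 2 ν :=
  (memLp_two_dual f).of_le (RCLike.continuous_conj.comp f.continuous).aestronglyMeasurable
    (ae_of_all _ fun x => (RCLike.norm_conj (f x)).le)

variable (𝕜) in
/-- The conjugate of a functional `f`, as an element of `L²(ν)`. -/
noncomputable def conjLp : StrongDual 𝕜 B →ₗ⋆[𝕜] Lp 𝕜 2 ν where
  toFun f := (memLp_two_conj_dual ν f).toLp _
  map_add' f g := by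
    rw [← MemLp.toLp_add]
    exact MemLp.toLp_congr _ _ (ae_of_all _ fun x => by simp)
  map_smul' c f := by
    rw [← MemLp.toLp_const_smul]
    exact MemLp.toLp_congr _ _ (ae_of_all _ fun x => by simp)

theorem coeFn_conjLp (f : StrongDual 𝕜 B) : conjLp 𝕜 ν f =ᵐ[ν] fun x => conj (f x) :=
  (memLp_two_conj_dual ν f).coeFn_toLp

theorem norm_conjLp_sq (f : StrongDual 𝕜 B) : ‖conjLp 𝕜 ν f‖ ^ 2 = ∫ x, ‖f x‖ ^ 2 ∂ν := by
  rw [@norm_sq_eq_re_inner 𝕜, L2.inner_def, ← integral_re (L2.integrable_inner _ _)]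
  refine integral_congr_ae ?_
  filter_upwards [coeFn_conjLp ν f] with x hx
  rw [hx, ← norm_sq_eq_re_inner, RCLike.norm_conj]

variable (𝕜) in
/-- The Cameron-Martin space, realised as the closure of the conjugates of `B'` in `L²(ν)`. -/
noncomputable def cameronMartin : Submodule 𝕜 (Lp 𝕜 2 ν) :=
  (LinearMap.range (conjLp 𝕜 ν)).topologicalClosure

instance : CompleteSpace (cameronMartin 𝕜 ν) :=
  (Submodule.isClosed_topologicalClosure _).completeSpace_coe

theorem conjLp_mem_cameronMartin (f : StrongDual 𝕜 B) : conjLp 𝕜 ν f ∈ cameronMartin 𝕜 ν :=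
  Submodule.le_topologicalClosure _ (LinearMap.mem_range_self _ f)

variable (𝕜) in
/-- The inclusion `g ↦ ∫ g(x) x dν(x)` of the Cameron-Martin space in `B`. -/
noncomputable def cameronMartinInclusion : cameronMartin 𝕜 ν →L[𝕜] B :=
  (((ContinuousLinearMap.lsmul 𝕜 𝕜 : 𝕜 →L[𝕜] B →L[𝕜] B).lpPairing ν 2 2).flip
    (IsGaussian.memLp_two_id (μ := ν)).toLp).comp (cameronMartin 𝕜 ν).subtypeL

/-- The functional passes through the Bochner integral. The conjugate compensates for the inner
product being conjugate-linear in its first argument. -/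
theorem apply_cameronMartinInclusion (f : StrongDual 𝕜 B) (g : cameronMartin 𝕜 ν) :
    f (cameronMartinInclusion 𝕜 ν g) = inner 𝕜 (conjLp 𝕜 ν f) (g : Lp 𝕜 2 ν) := by
  have h1 : cameronMartinInclusion 𝕜 ν g = ∫ x, (g : Lp 𝕜 2 ν) x • x ∂ν := by
    simp only [cameronMartinInclusion, ContinuousLinearMap.comp_apply,
      ContinuousLinearMap.flip_apply, ContinuousLinearMap.lpPairing_eq_integral]
    refine integral_congr_ae ?_
    filter_upwards [(IsGaussian.memLp_two_id (μ := ν)).coeFn_toLp] with x hx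
    rw [hx]; rfl
  have hint : Integrable (fun x => (g : Lp 𝕜 2 ν) x • x) ν :=
    memLp_one_iff_integrable.1
      ((IsGaussian.memLp_two_fun_id (μ := ν)).smul (Lp.memLp (g : Lp 𝕜 2 ν)))
  rw [h1, L2.inner_def, ← ContinuousLinearMap.integral_comp_comm f hint]
  refine integral_congr_ae ?_
  filter_upwards [coeFn_conjLp ν f] with x hx
  rw [hx]
  simp

theorem norm_comp_cameronMartinInclusion_sq (f : StrongDual 𝕜 B) :
    ‖f.comp (cameronMartinInclusion 𝕜 ν)‖ ^ 2 = ∫ x, ‖f x‖ ^ 2 ∂ν := by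
  have h : f.comp (cameronMartinInclusion 𝕜 ν)
      = InnerProductSpace.toDual 𝕜 _ ⟨conjLp 𝕜 ν f, conjLp_mem_cameronMartin ν f⟩ := by
    ext g
    simp [apply_cameronMartinInclusion]
  rw [h, LinearIsometryEquiv.norm_map, ← norm_conjLp_sq]
  rfl

/-- An element of the kernel is orthogonal to all conj f, hence to the closure in which it lies. -/
theorem injective_cameronMartinInclusion :
    Function.Injective (cameronMartinInclusion 𝕜 ν) := by
  rw [injective_iff_map_eq_zero]
  intro g hg
  have h : (g : Lp 𝕜 2 ν) ∈ (LinearMap.range (conjLp 𝕜 ν)).topologicalClosureᗮ := by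
    rw [Submodule.orthogonal_closure]
    rintro _ ⟨f, rfl⟩
    rw [← apply_cameronMartinInclusion, hg, map_zero]
  have h0 := Submodule.inner_right_of_mem_orthogonal g.2 h
  exact Subtype.ext (inner_self_eq_zero.1 h0)

theorem isAbstractWienerSpace_cameronMartinInclusion (hν : IsCentredRespProper 𝕜 ν)
    (hn : IsNondegenerate 𝕜 ν) : IsAbstractWienerSpace (cameronMartinInclusion 𝕜 ν) ν where
  completeSpace_H := inferInstance
  separableSpace_H := by
    have : Fact ((2 : ENNReal) ≠ ⊤) := ⟨by simp⟩
    have : SecondCountableTopology (Lp 𝕜 2 ν) := inferInstance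
    infer_instance
  completeSpace_B := inferInstance
  separableSpace_B := inferInstance
  borelSpace_B := inferInstance
  injective := injective_cameronMartinInclusion ν
  denseRange := by
    refine dense_of_forall_strongDual_eq_zero
      (LinearMap.range (cameronMartinInclusion 𝕜 ν).toLinearMap) fun f hf => ?_
    -- A nonzero f vanishing on the range would have E|f|² = ‖f ∘ i‖² = 0, against non-degeneracy.
    by_contra hne
    have h0 : f.comp (cameronMartinInclusion 𝕜 ν) = 0 :=
      ContinuousLinearMap.ext fun g => hf _ ⟨g, rfl⟩
    have h1 := hn f hne
    have h2 : ‖f.comp (cameronMartinInclusion 𝕜 ν)‖ = 0 := by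
      rw [h0]; exact ContinuousLinearMap.opNorm_zero
    have hc : IsCentred 𝕜 ν := by
      by_cases hI : (RCLike.I : 𝕜) = 0
      exacts [hν.1 hI, (hν.2 hI).1]
    rw [re_cov_self hc, ← norm_comp_cameronMartinInclusion_sq, h2] at h1
    simp at h1
  isProbabilityMeasure := inferInstance
  charFn_eq f := by
    rw [norm_comp_cameronMartinInclusion_sq, charFn_eq_exp_integral_norm_sq hν]

end Construction

/-! ### Infinite-dimensionality of H -/

section InfiniteDimensional

theorem not_finiteDimensional_of_denseRange {𝕜 H B : Type*} [RCLike 𝕜] [NormedAddCommGroup H]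
    [NormedSpace 𝕜 H] [NormedAddCommGroup B] [NormedSpace 𝕜 B] (i : H →L[𝕜] B)
    (hi : DenseRange i) (hB : ¬ FiniteDimensional 𝕜 B) : ¬ FiniteDimensional 𝕜 H := by
  intro hH
  have hc : IsClosed (LinearMap.range i.toLinearMap : Set B) :=
    Submodule.closed_of_finiteDimensional _
  have hs : Function.Surjective i := by
    intro x
    have := hc.closure_eq ▸ hi x
    exact this
  exact hB (Module.Finite.of_surjective i.toLinearMap hs)

end InfiniteDimensional

/-! ### The scalar Gaussian law -/

section StandardGaussian

variable (𝕜 : Type) [RCLike 𝕜]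

/-- The centred resp. proper Gaussian law of unit variance on `𝕜`. -/
noncomputable def scalarGaussian : Measure 𝕜 :=
  (stdGaussian 𝕜).map fun z => (‖(1 - RCLike.I : 𝕜)‖⁻¹ : ℝ) • z

instance : IsGaussian (scalarGaussian 𝕜) :=
  isGaussian_map (μ := stdGaussian 𝕜) ((‖(1 - RCLike.I : 𝕜)‖⁻¹ : ℝ) • ContinuousLinearMap.id ℝ 𝕜)

theorem integral_scalarGaussian : ∫ z, z ∂scalarGaussian 𝕜 = 0 := by
  rw [scalarGaussian, integral_map (by fun_prop) (by fun_prop), integral_smul,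
    integral_id_stdGaussian, smul_zero]

variable {𝕜}

theorem integral_exp_re_scalarGaussian (a : 𝕜) :
    ∫ z, Complex.exp ((RCLike.re (a * z) : ℝ) * Complex.I) ∂scalarGaussian 𝕜
      = Complex.exp (-(1 / 2 : ℂ) * (((‖a‖ / ‖(1 - RCLike.I : 𝕜)‖) ^ 2 : ℝ) : ℂ)) := by
  have h := charFun_stdGaussian ((‖(1 - RCLike.I : 𝕜)‖⁻¹ : ℝ) • conj a)
  rw [charFun_apply] at h
  rw [scalarGaussian, integral_map (by fun_prop) (by fun_prop)]
  have hz (z : 𝕜) : RCLike.re (a * ((‖(1 - RCLike.I : 𝕜)‖⁻¹ : ℝ) • z))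
      = inner ℝ z ((‖(1 - RCLike.I : 𝕜)‖⁻¹ : ℝ) • conj a) := by
    change _ = RCLike.re (((‖(1 - RCLike.I : 𝕜)‖⁻¹ : ℝ) • conj a) * conj z)
    rw [mul_smul_comm, smul_mul_assoc, RCLike.smul_re, RCLike.smul_re, ← map_mul, RCLike.conj_re]
  simp only [hz]
  rw [h, norm_smul, norm_inv, norm_norm, RCLike.norm_conj]
  congr 1
  push_cast
  ring

theorem memLp_two_id_scalarGaussian : MemLp id 2 (scalarGaussian 𝕜) :=
  IsGaussian.memLp_two_id

end StandardGaussian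

/-! ### Continuity of characteristic functions in L² -/

section Continuity

variable {𝕜 E Ω : Type*} [RCLike 𝕜] [NormedAddCommGroup E] [NormedSpace 𝕜 E] [MeasurableSpace Ω]
  {P : Measure Ω} [IsProbabilityMeasure P]

theorem norm_exp_mul_I_sub_le (a b : ℝ) :
    ‖Complex.exp (a * Complex.I) - Complex.exp (b * Complex.I)‖ ≤ |a - b| := by
  have h : Complex.exp (a * Complex.I) - Complex.exp (b * Complex.I)
      = Complex.exp (b * Complex.I) * (Complex.exp (Complex.I * ((a - b : ℝ) : ℂ)) - 1) := by
    rw [mul_sub, mul_one, ← Complex.exp_add]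
    congr 2
    push_cast
    ring
  rw [h, norm_mul, Complex.norm_exp_ofReal_mul_I, one_mul]
  exact Real.norm_exp_I_mul_ofReal_sub_one_le

theorem integral_norm_le_norm_Lp_two (F : Lp E 2 P) : ∫ ω, ‖F ω‖ ∂P ≤ ‖F‖ := by
  rw [integral_norm_eq_lintegral_enorm (Lp.aestronglyMeasurable F),
    ← eLpNorm_one_eq_lintegral_enorm, Lp.norm_def]
  exact ENNReal.toReal_mono (Lp.eLpNorm_ne_top F)
    (eLpNorm_le_eLpNorm_of_exponent_le one_le_two (Lp.aestronglyMeasurable F))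

/-- Lipschitz with constant ‖f‖, since t ↦ exp(it) is 1-Lipschitz and the L¹ norm is at most the L²
norm. -/
theorem continuous_integral_exp_re_Lp (f : StrongDual 𝕜 E) :
    Continuous fun F : Lp E 2 P =>
      ∫ ω, Complex.exp ((RCLike.re (f (F ω)) : ℝ) * Complex.I) ∂P := by
  have hm (F : Lp E 2 P) :
      Integrable (fun ω => Complex.exp ((RCLike.re (f (F ω)) : ℝ) * Complex.I)) P := by
    refine Integrable.of_bound (C := 1) ?_ (ae_of_all _ fun ω => ?_)
    · have hc : Continuous fun x : E => Complex.exp ((RCLike.re (f x) : ℝ) * Complex.I) := by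
        fun_prop
      exact hc.comp_aestronglyMeasurable (Lp.aestronglyMeasurable F)
    · rw [Complex.norm_exp_ofReal_mul_I]
  refine LipschitzWith.continuous (K := ‖f‖₊) (LipschitzWith.of_dist_le_mul fun F G => ?_)
  rw [dist_eq_norm, dist_eq_norm, ← integral_sub (hm F) (hm G)]
  have hFG : Integrable (F - G : Lp E 2 P) P := (Lp.memLp _).integrable one_le_two
  calc _ ≤ ∫ ω, ‖f‖ * ‖(F - G : Lp E 2 P) ω‖ ∂P := by
        refine norm_integral_le_of_norm_le (hFG.norm.const_mul _) ?_
        filter_upwards [Lp.coeFn_sub F G] with ω hω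
        refine (norm_exp_mul_I_sub_le _ _).trans ?_
        rw [hω, Pi.sub_apply, ← map_sub, ← map_sub]
        exact (RCLike.abs_re_le_norm _).trans (f.le_opNorm _)
    _ ≤ ‖f‖ * ‖F - G‖ := by
        rw [integral_const_mul]
        exact mul_le_mul_of_nonneg_left (integral_norm_le_norm_Lp_two _) (norm_nonneg _)

end Continuity

/-! ### Gaussian series in a Hilbert space -/

section Series

variable {𝕜 : Type} [RCLike 𝕜] {E ι : Type*} [NormedAddCommGroup E] [InnerProductSpace 𝕜 E]

theorem summable_of_pairwise_inner_eq_zero [CompleteSpace E] (G : ι → E)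
    (horth : Pairwise fun j k => inner 𝕜 (G j) (G k) = 0) (hs : Summable fun k => ‖G k‖ ^ 2) :
    Summable G := by
  -- Spans are used in place of normalised vectors, so that some `G k` may vanish.
  have hV : OrthogonalFamily 𝕜 (fun k => Submodule.span 𝕜 {G k})
      fun k => (Submodule.span 𝕜 {G k}).subtypeₗᵢ :=
    OrthogonalFamily.of_pairwise fun j k hjk => by
      change Submodule.span 𝕜 {G j} ⟂ Submodule.span 𝕜 {G k}
      rw [Submodule.isOrtho_span]
      rintro _ rfl _ rfl
      exact horth hjk
  exact (hV.summable_iff_norm_sq_summable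
    fun k => ⟨G k, Submodule.mem_span_singleton_self (G k)⟩).2 hs

variable (𝕜 ι) in
/-- The law of a family of independent scalar Gaussian variables. -/
noncomputable def whiteNoise : Measure (ι → 𝕜) := Measure.infinitePi fun _ : ι => scalarGaussian 𝕜

instance : IsProbabilityMeasure (whiteNoise 𝕜 ι) := by unfold whiteNoise; infer_instance

theorem measurePreserving_eval_whiteNoise (k : ι) :
    MeasurePreserving (fun ω : ι → 𝕜 => ω k) (whiteNoise 𝕜 ι) (scalarGaussian 𝕜) :=
  measurePreserving_eval_infinitePi _ k

theorem iIndepFun_whiteNoise : iIndepFun (fun (k : ι) (ω : ι → 𝕜) => ω k) (whiteNoise 𝕜 ι) :=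
  iIndepFun_infinitePi (P := fun _ : ι => scalarGaussian 𝕜) (X := fun _ => id)
    fun _ => measurable_id

/-- The `k`-th coordinate of the white noise times the vector `v`, as an element of `L²`. -/
noncomputable def coordLp (k : ι) (v : E) : Lp E 2 (whiteNoise 𝕜 ι) :=
  (ContinuousLinearMap.toSpanSingleton 𝕜 v).compLp
    (Lp.compMeasurePreserving _ (measurePreserving_eval_whiteNoise k)
      (memLp_two_id_scalarGaussian (𝕜 := 𝕜)).toLp)

theorem coeFn_coordLp (k : ι) (v : E) :
    coordLp (𝕜 := 𝕜) k v =ᵐ[whiteNoise 𝕜 ι] fun ω => ω k • v := by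
  filter_upwards [(ContinuousLinearMap.toSpanSingleton 𝕜 v).coeFn_compLp
      (Lp.compMeasurePreserving _ (measurePreserving_eval_whiteNoise k)
        (memLp_two_id_scalarGaussian (𝕜 := 𝕜)).toLp),
    Lp.coeFn_compMeasurePreserving (memLp_two_id_scalarGaussian (𝕜 := 𝕜)).toLp
      (measurePreserving_eval_whiteNoise k),
    (measurePreserving_eval_whiteNoise k).quasiMeasurePreserving.ae_eq_comp
      (memLp_two_id_scalarGaussian (𝕜 := 𝕜)).coeFn_toLp] with ω h1 h2 h3
  rw [coordLp, h1, h2, h3]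
  simp

theorem norm_coordLp_le (k : ι) (v : E) :
    ‖coordLp (𝕜 := 𝕜) k v‖ ≤ ‖v‖ * ‖(memLp_two_id_scalarGaussian (𝕜 := 𝕜)).toLp‖ := by
  refine (ContinuousLinearMap.norm_compLp_le _ _).trans ?_
  rw [ContinuousLinearMap.norm_toSpanSingleton, Lp.norm_compMeasurePreserving]

/-- Independent coordinates with mean zero are uncorrelated. -/
theorem inner_coordLp_of_ne {j k : ι} (hjk : j ≠ k) (v w : E) :
    inner 𝕜 (coordLp (𝕜 := 𝕜) j v) (coordLp (𝕜 := 𝕜) k w) = 0 := by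
  have hind : IndepFun (fun ω : ι → 𝕜 => conj (ω j)) (fun ω : ι → 𝕜 => ω k) (whiteNoise 𝕜 ι) :=
    (iIndepFun_whiteNoise.indepFun hjk).comp (φ := fun z => conj z)
      RCLike.continuous_conj.measurable measurable_id
  have hk : ∫ ω, ω k ∂whiteNoise 𝕜 ι = 0 := by
    rw [← integral_scalarGaussian 𝕜, ← (measurePreserving_eval_whiteNoise k).map_eq,
      integral_map (measurable_pi_apply k).aemeasurable (by fun_prop)]
  have h0 : ∫ ω, conj (ω j) * ω k ∂whiteNoise 𝕜 ι = 0 := by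
    rw [hind.integral_fun_mul_eq_mul_integral
      (RCLike.continuous_conj.measurable.comp (measurable_pi_apply j)).aestronglyMeasurable
      (measurable_pi_apply k).aestronglyMeasurable, hk, mul_zero]
  rw [L2.inner_def]
  calc _ = ∫ ω, conj (ω j) * ω k * inner 𝕜 v w ∂whiteNoise 𝕜 ι := by
        refine integral_congr_ae ?_
        filter_upwards [coeFn_coordLp j v, coeFn_coordLp k w] with ω h1 h2
        rw [h1, h2, inner_smul_left, inner_smul_right, mul_assoc]
    _ = 0 := by rw [integral_mul_const, h0, zero_mul]

/-- Independence factors the exponential of the sum into scalar characteristic functions. -/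
theorem integral_exp_re_sum_coordLp (f : StrongDual 𝕜 E) (v : ι → E) (s : Finset ι) :
    ∫ ω, Complex.exp ((RCLike.re (f ((∑ k ∈ s, coordLp (𝕜 := 𝕜) k (v k) : Lp E 2 _) ω)) : ℝ)
        * Complex.I) ∂whiteNoise 𝕜 ι
      = Complex.exp (-(1 / 2 : ℂ) *
        ((∑ k ∈ s, (‖f (v k)‖ / ‖(1 - RCLike.I : 𝕜)‖) ^ 2 : ℝ) : ℂ)) := by
  have hsum : ∀ᵐ ω ∂whiteNoise 𝕜 ι,
      (∑ k ∈ s, coordLp (𝕜 := 𝕜) k (v k) : Lp E 2 _) ω = ∑ k ∈ s, ω k • v k := by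
    have h : ∀ᵐ ω ∂whiteNoise 𝕜 ι, ∀ k ∈ s, coordLp (𝕜 := 𝕜) k (v k) ω = ω k • v k :=
      (Finset.eventually_all s).2 fun k _ => coeFn_coordLp k (v k)
    filter_upwards [h, Lp.coeFn_finsetSum s fun k => coordLp (𝕜 := 𝕜) k (v k)] with ω h1 h2
    rw [h2, Finset.sum_apply]
    exact Finset.sum_congr rfl h1
  have hind : iIndepFun (fun (k : s) (ω : ι → 𝕜) => ω k) (whiteNoise 𝕜 ι) :=
    iIndepFun_whiteNoise.precomp Subtype.val_injective
  calc _ = ∫ ω, ∏ k : s, Complex.exp ((RCLike.re (f (v k) * ω k) : ℝ) * Complex.I)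
          ∂whiteNoise 𝕜 ι := by
        refine integral_congr_ae ?_
        filter_upwards [hsum] with ω h
        rw [h, ← Complex.exp_sum, ← Finset.sum_mul, Finset.sum_coe_sort s
          fun k => ((RCLike.re (f (v k) * ω k) : ℝ) : ℂ)]
        simp [mul_comm]
    _ = ∏ k : s, ∫ ω, Complex.exp ((RCLike.re (f (v k) * ω k) : ℝ) * Complex.I)
          ∂whiteNoise 𝕜 ι :=
        hind.integral_fun_prod_comp
          (f := fun (k : s) (z : 𝕜) =>
            Complex.exp ((RCLike.re (f (v k) * z) : ℝ) * Complex.I))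
          (fun k => (measurable_pi_apply (k : ι)).aemeasurable) (fun k => by fun_prop)
    _ = _ := by
        have hk (k : ι) : ∫ ω, Complex.exp ((RCLike.re (f (v k) * ω k) : ℝ) * Complex.I)
            ∂whiteNoise 𝕜 ι = Complex.exp (-(1 / 2 : ℂ) *
              (((‖f (v k)‖ / ‖(1 - RCLike.I : 𝕜)‖) ^ 2 : ℝ) : ℂ)) := by
          rw [← integral_exp_re_scalarGaussian, ← (measurePreserving_eval_whiteNoise k).map_eq,
            integral_map (measurable_pi_apply k).aemeasurable (by fun_prop)]
        rw [Finset.prod_coe_sort s fun k => ∫ ω, Complex.exp ((RCLike.re (f (v k) * ω k) : ℝ)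
          * Complex.I) ∂whiteNoise 𝕜 ι]
        simp only [hk]
        rw [← Complex.exp_sum, ← Finset.mul_sum, Complex.ofReal_sum]

/-- The series converges in L² by orthogonality, so both sides are limits of the identity for finite
partial sums. -/
theorem integral_exp_re_tsum_coordLp [CompleteSpace E] {v : ι → E}
    (hv : Summable fun k => ‖v k‖ ^ 2) (f : StrongDual 𝕜 E) :
    ∫ ω, Complex.exp ((RCLike.re (f ((∑' k, coordLp (𝕜 := 𝕜) k (v k) : Lp E 2 _) ω)) : ℝ)
        * Complex.I) ∂whiteNoise 𝕜 ι
      = Complex.exp (-(1 / 2 : ℂ) *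
        ((∑' k, (‖f (v k)‖ / ‖(1 - RCLike.I : 𝕜)‖) ^ 2 : ℝ) : ℂ)) := by
  have hs : Summable fun k => coordLp (𝕜 := 𝕜) k (v k) := by
    refine summable_of_pairwise_inner_eq_zero (𝕜 := 𝕜) _
      (fun j k hjk => inner_coordLp_of_ne hjk _ _) ?_
    refine Summable.of_nonneg_of_le (fun k => sq_nonneg _) (fun k => ?_)
      (hv.mul_right (‖(memLp_two_id_scalarGaussian (𝕜 := 𝕜)).toLp‖ ^ 2))
    rw [← mul_pow]
    exact pow_le_pow_left₀ (norm_nonneg _) (norm_coordLp_le k (v k)) 2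
  have hf : Summable fun k => (‖f (v k)‖ / ‖(1 - RCLike.I : 𝕜)‖) ^ 2 := by
    simp only [div_pow]
    refine Summable.div_const (Summable.of_nonneg_of_le (fun k => sq_nonneg _) (fun k => ?_)
      (hv.mul_left (‖f‖ ^ 2))) _
    rw [← mul_pow]
    exact pow_le_pow_left₀ (norm_nonneg _) (f.le_opNorm _) 2
  have h1 := ((continuous_integral_exp_re_Lp f).tendsto _).comp hs.hasSum
  have hc : Continuous fun r : ℝ => Complex.exp (-(1 / 2 : ℂ) * (r : ℂ)) := by fun_prop
  have h2 := (hc.tendsto _).comp hf.hasSum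
  refine tendsto_nhds_unique h1 (h2.congr fun s => ?_)
  exact (integral_exp_re_sum_coordLp f v s).symm

variable (𝕜) in
/-- The law on `E` of the random series `∑ ξₖ vₖ` with independent scalar Gaussian `ξₖ`. -/
noncomputable def gaussianSeriesLaw [MeasurableSpace E] (v : ι → E) : Measure E :=
  (whiteNoise 𝕜 ι).map (∑' k, coordLp (𝕜 := 𝕜) k (v k) : Lp E 2 _)

end Series

/-! ### The law of the Gaussian series -/

section Law

variable {𝕜 : Type} [RCLike 𝕜] {E : Type u} {ι : Type*} [NormedAddCommGroup E]
  [InnerProductSpace 𝕜 E] [CompleteSpace E] [MeasurableSpace E] [BorelSpace E]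

instance (v : ι → E) : IsProbabilityMeasure (gaussianSeriesLaw 𝕜 v) :=
  Measure.isProbabilityMeasure_map (Lp.aestronglyMeasurable _).aemeasurable

theorem charFn_gaussianSeriesLaw {v : ι → E} (hv : Summable fun k => ‖v k‖ ^ 2)
    (f : StrongDual 𝕜 E) :
    charFn (gaussianSeriesLaw 𝕜 v) f
      = Complex.exp (-(1 / 2 : ℂ) * ((∑' k, ‖f (v k)‖ ^ 2 : ℝ) : ℂ)) := by
  have hc : Continuous fun x : E => Complex.exp
      ((RCLike.re (((1 - RCLike.I : 𝕜) • f) x) : ℝ) * Complex.I) := by fun_prop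
  have hx (x : E) : RCLike.re (f x) + RCLike.im (f x)
      = RCLike.re (((1 - RCLike.I : 𝕜) • f) x) := by
    rw [smul_apply, smul_eq_mul, re_one_sub_I_mul]
  simp only [charFn, hx]
  rw [gaussianSeriesLaw, integral_map (Lp.aestronglyMeasurable _).aemeasurable
    hc.measurable.aestronglyMeasurable, integral_exp_re_tsum_coordLp hv]
  have hn : ‖(1 - RCLike.I : 𝕜)‖ ≠ 0 := norm_ne_zero_iff.2 one_sub_I_ne_zero
  simp only [smul_apply, smul_eq_mul, norm_mul, mul_div_cancel_left₀ _ hn]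

end Law

/-! ### Existence from a Hilbert–Schmidt operator -/

section HilbertSchmidt

variable {𝕜 : Type} [RCLike 𝕜] {H : Type u} [NormedAddCommGroup H] [InnerProductSpace 𝕜 H]
  [CompleteSpace H]

/-- The operator on `H` that corresponds to `A` on `H'` under the Riesz identification. For injective
`A` with dense range, it identifies `H` itself with the completion of `H` in the norm `x ↦ ‖A x‖`. -/
noncomputable def rieszConj (A : StrongDual 𝕜 H →L[𝕜] StrongDual 𝕜 H) : H →L[𝕜] H :=
  ((InnerProductSpace.toDual 𝕜 H).symm.toContinuousLinearEquiv :
      StrongDual 𝕜 H →L⋆[𝕜] H).comp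
    (A.comp ((InnerProductSpace.toDual 𝕜 H).toContinuousLinearEquiv : H →L⋆[𝕜] StrongDual 𝕜 H))

theorem rieszConj_apply (A : StrongDual 𝕜 H →L[𝕜] StrongDual 𝕜 H) (x : H) :
    rieszConj A x
      = (InnerProductSpace.toDual 𝕜 H).symm (A (InnerProductSpace.toDual 𝕜 H x)) := rfl

theorem injective_rieszConj {A : StrongDual 𝕜 H →L[𝕜] StrongDual 𝕜 H} (hA : IsPositiveOp A) :
    Function.Injective (rieszConj A) := by
  rw [injective_iff_map_eq_zero]
  intro x hx
  by_contra hne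
  have h := hA (InnerProductSpace.toDual 𝕜 H x) (by simpa using hne)
  rw [dualInner, ← rieszConj_apply, hx] at h
  simp at h

/-- Self-adjointness places a vector orthogonal to the range in the kernel, which is trivial by
positivity. -/
theorem denseRange_rieszConj {A : StrongDual 𝕜 H →L[𝕜] StrongDual 𝕜 H} (hA : IsPositiveOp A)
    (hsa : IsSelfAdjointOp A) : DenseRange (rieszConj A) := by
  refine dense_of_forall_strongDual_eq_zero (LinearMap.range (rieszConj A).toLinearMap)
    fun f hf => ?_
  obtain ⟨y, rfl⟩ := (InnerProductSpace.toDual 𝕜 H).surjective f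
  have hy : rieszConj A y = 0 := by
    refine ext_inner_right 𝕜 fun x => ?_
    have h1 := hsa (InnerProductSpace.toDual 𝕜 H y) (InnerProductSpace.toDual 𝕜 H x)
    simp only [dualInner, ← rieszConj_apply, LinearIsometryEquiv.symm_apply_apply] at h1
    rw [h1, inner_zero_left]
    exact hf _ ⟨x, rfl⟩
  rw [injective_rieszConj hA (hy.trans (map_zero _).symm), map_zero]

theorem tsum_norm_sq_apply_hilbertBasis {ι : Type*} (b : HilbertBasis ι 𝕜 H)
    (f : StrongDual 𝕜 H) : ∑' k, ‖f (b k)‖ ^ 2 = ‖f‖ ^ 2 := by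
  obtain ⟨y, rfl⟩ := (InnerProductSpace.toDual 𝕜 H).surjective f
  have h := RCLike.hasSum_re _ (b.hasSum_inner_mul_inner y y)
  rw [inner_self_eq_norm_sq] at h
  rw [LinearIsometryEquiv.norm_map, ← h.tsum_eq]
  refine tsum_congr fun k => ?_
  rw [InnerProductSpace.toDual_apply_apply, inner_mul_symm_re_eq_norm, norm_mul,
    norm_inner_symm (b k), sq]

theorem isAbstractWienerSpace_rieszConj [TopologicalSpace.SeparableSpace H] [MeasurableSpace H]
    [BorelSpace H] {A : StrongDual 𝕜 H →L[𝕜] StrongDual 𝕜 H} (hA : IsPositiveOp A)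
    (hsa : IsSelfAdjointOp A) {ι : Type*} (b : HilbertBasis ι 𝕜 H)
    (hb : Summable fun k => ‖A (InnerProductSpace.toDual 𝕜 H (b k))‖ ^ 2) :
    IsAbstractWienerSpace (rieszConj A) (gaussianSeriesLaw 𝕜 fun k => rieszConj A (b k)) where
  completeSpace_H := inferInstance
  separableSpace_H := inferInstance
  completeSpace_B := inferInstance
  separableSpace_B := inferInstance
  borelSpace_B := inferInstance
  injective := injective_rieszConj hA
  denseRange := denseRange_rieszConj hA hsa
  isProbabilityMeasure := inferInstance
  charFn_eq f := by
    -- Parseval is applied to f ∘ i, whose value at bₖ is f(A bₖ), with A transported to H.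
    rw [charFn_gaussianSeriesLaw (by simpa only [rieszConj_apply, LinearIsometryEquiv.norm_map]),
      ← tsum_norm_sq_apply_hilbertBasis b]
    rfl

end HilbertSchmidt

end Wiener

theorem theorem3p2 {𝕜 : Type} [RCLike 𝕜] :
    -- (i)
    (∀ (H : Type u) [NormedAddCommGroup H] [InnerProductSpace 𝕜 H] [CompleteSpace H]
        [TopologicalSpace.SeparableSpace H] (A : StrongDual 𝕜 H →L[𝕜] StrongDual 𝕜 H),
      ¬ FiniteDimensional 𝕜 H →
      Wiener.IsPositiveOp A → Wiener.IsSelfAdjointOp A → Wiener.IsHilbertSchmidtOp A →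
      ∃ (B : Type u) (_ : NormedAddCommGroup B) (_ : InnerProductSpace 𝕜 B)
        (_ : MeasurableSpace B) (i : H →L[𝕜] B) (ν : Measure B),
        ¬ FiniteDimensional 𝕜 B ∧ Wiener.IsAbstractWienerSpace i ν) ∧
    -- (ii)
    (∀ (B : Type u) [NormedAddCommGroup B] [NormedSpace 𝕜 B] [CompleteSpace B]
        [TopologicalSpace.SeparableSpace B] [MeasurableSpace B] [BorelSpace B]
        (ν : Measure B) [IsProbabilityMeasure ν],
      ¬ FiniteDimensional 𝕜 B →
      ((Wiener.IsGaussianMeasure 𝕜 ν ∧ Wiener.IsCentredRespProper 𝕜 ν ∧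
          Wiener.IsNondegenerate 𝕜 ν) ↔
        ∃ (H : Type u) (_ : NormedAddCommGroup H) (_ : InnerProductSpace 𝕜 H) (i : H →L[𝕜] B),
          ¬ FiniteDimensional 𝕜 H ∧ Wiener.IsAbstractWienerSpace i ν) ∧
      -- uniqueness of `H` as a Hilbert space contained in `B`
      (∀ (H₁ H₂ : Type u) [NormedAddCommGroup H₁] [InnerProductSpace 𝕜 H₁]
          [NormedAddCommGroup H₂] [InnerProductSpace 𝕜 H₂]
          (i₁ : H₁ →L[𝕜] B) (i₂ : H₂ →L[𝕜] B),
        Wiener.IsAbstractWienerSpace i₁ ν → Wiener.IsAbstractWienerSpace i₂ ν →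
        ∃ U : H₁ ≃ₗᵢ[𝕜] H₂, ∀ x, i₂ (U x) = i₁ x)) := by
  refine ⟨fun H _ _ _ _ A hH hpos hsa ⟨w, b, hb⟩ => ?_, fun B _ _ _ _ _ _ ν _ hB => ⟨⟨?_, ?_⟩, ?_⟩⟩
  · let _ : MeasurableSpace H := borel H
    have : BorelSpace H := ⟨rfl⟩
    exact ⟨H, inferInstance, inferInstance, inferInstance, Wiener.rieszConj A, _, hH,
      Wiener.isAbstractWienerSpace_rieszConj hpos hsa b hb⟩
  · rintro ⟨hg, hc, hn⟩
    let _ : NormedSpace ℝ B := NormedSpace.restrictScalars ℝ 𝕜 B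
    have : IsScalarTower ℝ 𝕜 B := .restrictScalars ℝ 𝕜 B
    have : SecondCountableTopology B := UniformSpace.secondCountable_of_separable B
    have : IsGaussian ν := (Wiener.isGaussianMeasure_iff_isGaussian (𝕜 := 𝕜) ν).1 hg
    have h := Wiener.isAbstractWienerSpace_cameronMartinInclusion ν hc hn
    exact ⟨_, inferInstance, inferInstance, Wiener.cameronMartinInclusion 𝕜 ν,
      Wiener.not_finiteDimensional_of_denseRange _ h.denseRange hB, h⟩
  · rintro ⟨H, _, _, i, -, h⟩
    let _ : NormedSpace ℝ B := NormedSpace.restrictScalars ℝ 𝕜 B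
    have : IsScalarTower ℝ 𝕜 B := .restrictScalars ℝ 𝕜 B
    have : SecondCountableTopology B := UniformSpace.secondCountable_of_separable B
    exact ⟨(Wiener.isGaussianMeasure_iff_isGaussian (𝕜 := 𝕜) ν).2 h.isGaussian,
      h.isCentredRespProper, h.isNondegenerate⟩
  · intro H₁ H₂ _ _ _ _ i₁ i₂ h₁ h₂
    exact h₁.exists_linearIsometryEquiv h₂
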